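/- Theorem 4.2. Let $H$ be a finite-dimensional complex Hilbert space with scalar product $\langle\cdot,\cdot\rangle$ linear in the first argument, and let $c:H\to H$ be a conjugation (an antilinear isometry with $c^2=1$). Let $\iota(v)=\big(\tfrac12(v+c(v)),\tfrac1{2i}(v-c(v))\big)$, let $H_{\mathbb R}=\iota(H)\subset H\times H$ be the realification of $H$, a real inner product space with $\langle\iota(v),\iota(w)\rangle=\mathrm{Re}\langle v,w\rangle$, and let $J(u,v)=(-v,u)$ on $H_{\mathbb R}$. For $u\in H_{\mathbb R}$ write $uu^*$ for the operator $\xi\mapsto\langle\xi,u\rangle u$. Let $f_1,\dots,f_m\in H$, $\varphi_k=\iota(f_k)$ and $\Phi_k=\varphi_k\varphi_k^*+J\varphi_k\varphi_k^*J^*$. Assume that the map $\alpha$, $\alpha(x)=(|\langle x,f_k\rangle|^2)_{1\le k\le m}$, is injective on the quotient of $H$ by $x\sim zx$, $|z|=1$. Let $\sigma>0$ and, for $x\in H$, let $y=\alpha(x)+\nu$, where $\nu\in\mathbb R^m$ has independent $\mathcal N(0,\sigma^2)$ components; $\mathcal E[\,\cdot\,|x]$ is the expectation under the resulting law of $y$.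 Fix $z_0\in H$ with $\|z_0\|=1$, let $\psi_0=\iota(z_0)$, $\Pi=1-J\psi_0\psi_0^*J^*$, and $H_{z_0}=\{\xi\in H_{\mathbb R}:\langle\xi,\psi_0\rangle\ge0,\ \langle\xi,J\psi_0\rangle=0\}$. Call $x\in H$ admissible if $\langle x,z_0\rangle$ is real and positive. Let $x$ be admissible, $\zeta=\iota(x)$, and let $\omega:\mathbb R^m\to H_{z_0}$ be an estimator that is unbiased at $x$ to first order: $\omega(y)$ is integrable under the law of $y$ given $x$ and given every admissible $x'$ near $x$, $\mathcal E[\omega(y)|x]=\zeta$, and $$\mathcal E[\omega(y)|x']=\iota(x')+o(\|x'-x\|)\qquad\text{as } x'\to x,\ x'\text{ admissible}.$$ (In particular this holds if $\mathcal E[\omega(y)|x']=\iota(x')$ for every admissible $x'$.) Then: 1. If $\omega(y)$ is square integrable under the law of $y$ given $x$, its covariance operator on $H_{\mathbb R}$ satisfies, in the sense of quadratic forms, $$\mathrm{Cov}[\omega(y)|x]\ \ge\ \frac{\sigma^2}{4}\Big(\sum_{k=1}^m\Pi\Phi_k\zeta\zeta^*\Phi_k\Pi\Big)^{\dagger},$$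 where $\dagger$ is the Moore-Penrose pseudoinverse. 2. In all cases the mean square error, as an element of $[0,\infty]$, satisfies $$\mathcal E\big[\|\zeta-\omega(y)\|^2\,\big|\,x\big]\ \ge\ \frac{\sigma^2}{4}\,\mathrm{tr}\Big\{\Big(\sum_{k=1}^m\Pi\Phi_k\zeta\zeta^*\Phi_k\Pi\Big)^{\dagger}\Big\}.$$ -/

import Mathlib

open MeasureTheory ProbabilityTheory Filter Topology
open scoped ENNReal NNReal Asymptotics ComplexConjugate

noncomputable section

namespace PhaseRetrieval

/-! ### The Moore-Penrose pseudoinverse -/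

section Pseudoinverse

variable {E : Type*} [NormedAddCommGroup E] [InnerProductSpace ℝ E] [FiniteDimensional ℝ E]

/-- The four Penrose equations: `S` is a Moore-Penrose pseudoinverse of `T`. -/
structure IsMoorePenrose (T S : E →L[ℝ] E) : Prop where
  mul_mul_self : T * S * T = T
  self_mul_mul : S * T * S = S
  selfAdjoint_left : IsSelfAdjoint (T * S)
  selfAdjoint_right : IsSelfAdjoint (S * T)

theorem IsMoorePenrose.unique {T S S' : E →L[ℝ] E} (h : IsMoorePenrose T S)
    (h' : IsMoorePenrose T S') : S = S' := by
  have a : T * S = T * S' := by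
    have e1 : star (T * S) = T * S := h.selfAdjoint_left
    have e2 : star (T * S') = T * S' := h'.selfAdjoint_left
    calc T * S = star (T * S) := e1.symm
      _ = star ((T * S') * (T * S)) := by rw [← mul_assoc, h'.mul_mul_self]
      _ = (T * S) * (T * S') := by rw [star_mul, e1, e2]
      _ = T * S' := by rw [← mul_assoc, h.mul_mul_self]
  have b : S * T = S' * T := by
    have e1 : star (S * T) = S * T := h.selfAdjoint_right
    have e2 : star (S' * T) = S' * T := h'.selfAdjoint_right
    calc S * T = star (S * T) := e1.symm
      _ = star ((S * T) * (S' * T)) := by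
          rw [mul_assoc, ← mul_assoc T S' T, h'.mul_mul_self]
      _ = (S' * T) * (S * T) := by rw [star_mul, e1, e2]
      _ = S' * T := by rw [mul_assoc, ← mul_assoc T S T, h.mul_mul_self]
  calc S = S * T * S := h.self_mul_mul.symm
    _ = S' * (T * S) := by rw [b, mul_assoc]
    _ = S' * T * S' := by rw [a, mul_assoc]
    _ = S' := h'.self_mul_mul

theorem exists_isMoorePenrose (T : E →L[ℝ] E) : ∃ S, IsMoorePenrose T S := by
  let K : Submodule ℝ E := LinearMap.ker (T : E →ₗ[ℝ] E)
  let L : Submodule ℝ E := LinearMap.range (T : E →ₗ[ℝ] E)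
  have key : ∀ y : L, ∃! u : Kᗮ, T u = y := by
    rintro ⟨y, x, rfl⟩
    refine ⟨Kᗮ.orthogonalProjectionOnto x, ?_, ?_⟩
    · have h1 : x - Kᗮ.starProjection x ∈ Kᗮᗮ := Submodule.sub_starProjection_mem_orthogonal x
      rw [Submodule.orthogonal_orthogonal] at h1
      have h2 : T (x - Kᗮ.starProjection x) = 0 := h1
      rw [map_sub, sub_eq_zero] at h2
      exact h2.symm
    · intro u hu
      have hP : x - Kᗮ.starProjection x ∈ Kᗮᗮ := Submodule.sub_starProjection_mem_orthogonal x
      rw [Submodule.orthogonal_orthogonal] at hP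
      have h2 : T (x - Kᗮ.starProjection x) = 0 := hP
      have h3 : ((u : E) - Kᗮ.starProjection x) ∈ K := by
        change T _ = 0
        rw [map_sub] at h2 ⊢
        have hu' : T u = T x := hu
        rw [hu']; exact h2
      have h4 : ((u : E) - Kᗮ.starProjection x) ∈ Kᗮ :=
        Submodule.sub_mem _ u.2 (Kᗮ.orthogonalProjectionOnto x).2
      have h5 := Submodule.disjoint_def.1 K.orthogonal_disjoint _ h3 h4
      exact Subtype.ext (sub_eq_zero.1 h5)
  choose g hg hguniq using key
  have hguniq' : ∀ (y : L) (u : Kᗮ), T u = y → u = g y := fun y u h => hguniq y u h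
  let gl : L →ₗ[ℝ] Kᗮ :=
    { toFun := g
      map_add' := fun y z => (hguniq' _ _ (by
        have h1 : T (g y) = y := hg y
        have h2 : T (g z) = z := hg z
        simp [h1, h2])).symm
      map_smul' := fun a y => (hguniq' _ _ (by
        have h1 : T (g y) = y := hg y
        simp [h1])).symm }
  let S : E →L[ℝ] E := LinearMap.toContinuousLinearMap
    (Kᗮ.subtype ∘ₗ gl ∘ₗ (L.orthogonalProjectionOnto : E →ₗ[ℝ] L))
  have hS : ∀ y, S y = g (L.orthogonalProjectionOnto y) := fun y => rfl
  have hTS : T * S = L.starProjection := by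
    ext y
    have h : T (g (L.orthogonalProjectionOnto y)) = L.orthogonalProjectionOnto y := hg _
    simp only [mul_apply_eq_comp, hS, h]
    rfl
  have hST : S * T = Kᗮ.starProjection := by
    ext x
    have h0 : L.orthogonalProjectionOnto (T x) = ⟨T x, x, rfl⟩ :=
      Submodule.orthogonalProjectionOnto_mem_subspace_eq_self (K := L) ⟨T x, x, rfl⟩
    have hP : x - Kᗮ.starProjection x ∈ Kᗮᗮ := Submodule.sub_starProjection_mem_orthogonal x
    rw [Submodule.orthogonal_orthogonal] at hP
    have h2 : T (x - Kᗮ.starProjection x) = 0 := hP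
    rw [map_sub, sub_eq_zero] at h2
    simp only [mul_apply_eq_comp, hS, h0]
    rw [← hguniq' ⟨T x, x, rfl⟩ (Kᗮ.orthogonalProjectionOnto x) h2.symm]
    rfl
  refine ⟨S, ?_, ?_, ?_, ?_⟩
  · rw [hTS]; ext x
    exact Submodule.starProjection_eq_self_iff.2 ⟨x, rfl⟩
  · rw [hST]; ext x
    exact Submodule.starProjection_eq_self_iff.2 (g (L.orthogonalProjectionOnto x)).2
  · rw [hTS]; exact isSelfAdjoint_starProjection L
  · rw [hST]; exact isSelfAdjoint_starProjection Kᗮ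

/-- The pseudoinverse `T†`: the unique solution of the Penrose equations. -/
def pinv (T : E →L[ℝ] E) : E →L[ℝ] E := (exists_isMoorePenrose T).choose

theorem isMoorePenrose_pinv (T : E →L[ℝ] E) : IsMoorePenrose T (pinv T) :=
  (exists_isMoorePenrose T).choose_spec

end Pseudoinverse

section Covariance

variable {Y : Type*} [MeasurableSpace Y] {E : Type*} [NormedAddCommGroup E]
  [InnerProductSpace ℝ E]

/-- The covariance operator `E[(X - E X)(X - E X)*]` of a square integrable random vector `X`. -/
def covOp (X : Y → E) (P : Measure Y) : E →L[ℝ] E :=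
  ∫ y, InnerProductSpace.rankOne ℝ (X y - ∫ z, X z ∂P) (X y - ∫ z, X z ∂P) ∂P

end Covariance

section Model

variable {H : Type*} [NormedAddCommGroup H] [InnerProductSpace ℂ H]

/-- Equality up to a global phase: `x ∼ y` iff `y = z x` with `|z| = 1`. -/
def phaseSetoid (H : Type*) [NormedAddCommGroup H] [InnerProductSpace ℂ H] : Setoid H where
  r x y := ∃ z : ℂ, ‖z‖ = 1 ∧ y = z • x
  iseqv :=
    { refl := fun x => ⟨1, by simp, by simp⟩
      symm := by
        rintro x y ⟨z, hz, rfl⟩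
        have hz0 : z ≠ 0 := by
          rintro rfl
          simp at hz
        exact ⟨z⁻¹, by simp [hz], by simp [smul_smul, hz0]⟩
      trans := by
        rintro x y w ⟨z, hz, rfl⟩ ⟨z', hz', rfl⟩
        exact ⟨z' * z, by simp [hz, hz'], by simp [smul_smul]⟩ }

/-- The measurements `(|⟨x, f_k⟩|²)_k` of a vector `x`. (Mathlib's inner product is linear in its
second argument, so `inner ℂ (f k) x` is the scalar product of `x` with `f k` that is linear
in `x`.) -/
def intensity {m : ℕ} (f : Fin m → H) (x : H) : Fin m → ℝ := fun k => ‖inner ℂ (f k) x‖ ^ 2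

/-- The map `α : H/∼ → ℝᵐ` induced by the measurements. -/
def α {m : ℕ} (f : Fin m → H) : Quotient (phaseSetoid H) → Fin m → ℝ :=
  Quotient.lift (intensity f) (by
    rintro x _ ⟨z, hz, rfl⟩
    funext k
    simp [intensity, hz])

/-- The law of `y = α(x) + ν`, where `ν` has independent `N(0, σ²)` components. -/
def obsLaw {m : ℕ} (f : Fin m → H) (σ : ℝ) (x : H) : Measure (Fin m → ℝ) :=
  Measure.pi fun k => gaussianReal (intensity f x k) (σ ^ 2).toNNReal

/-- The admissible signals `x`, those with `⟨x, z₀⟩ > 0` (real and positive). -/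
def admissible (z₀ : H) : Set H := {x | 0 < (inner ℂ z₀ x).re ∧ (inner ℂ z₀ x).im = 0}

/-- The map `v ↦ ((v + c v)/2, (v - c v)/(2i))` from `H` to `H × H` (with the `ℓ²` product norm). -/
def realifyAux (c : H ≃ₗᵢ⋆[ℂ] H) : H →ₗ[ℝ] WithLp 2 (H × H) where
  toFun v := WithLp.toLp 2 ((1 / 2 : ℂ) • (v + c v), (1 / (2 * Complex.I) : ℂ) • (v - c v))
  map_add' v w := by
    rw [← WithLp.toLp_add]
    congr 1
    ext <;> simp only [map_add, Prod.fst_add, Prod.snd_add] <;> module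
  map_smul' a v := by
    rw [← WithLp.toLp_smul]
    congr 1
    have h : c (a • v) = a • c v := by
      rw [← Complex.coe_smul a v, map_smulₛₗ]
      simp
    ext <;> simp only [h, Prod.smul_fst, Prod.smul_snd, RingHom.id_apply, ← smul_add, ← smul_sub]
      <;> rw [smul_comm]

/-- The realification `H_ℝ` of `H`: the image of `H` in `H × H`. -/
def realification (c : H ≃ₗᵢ⋆[ℂ] H) : Submodule ℝ (WithLp 2 (H × H)) :=
  LinearMap.range (realifyAux c)

/-- The real inner product of `H_ℝ`, induced by the real part of the inner product of `H × H`. -/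
instance (c : H ≃ₗᵢ⋆[ℂ] H) : InnerProductSpace ℝ (realification c) :=
  letI : InnerProductSpace ℝ (WithLp 2 (H × H)) := InnerProductSpace.complexToReal
  Submodule.innerProductSpace (realification c)

instance [FiniteDimensional ℂ H] (c : H ≃ₗᵢ⋆[ℂ] H) : FiniteDimensional ℝ (realification c) :=
  LinearMap.finiteDimensional_range (realifyAux c)

/-- The map `ι : H → H_ℝ`. -/
def ι (c : H ≃ₗᵢ⋆[ℂ] H) : H →ₗ[ℝ] realification c := (realifyAux c).rangeRestrict

/-- The map `(v, w) ↦ (-w, v)` on `H × H`. -/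
def rotAux : WithLp 2 (H × H) →ₗ[ℝ] WithLp 2 (H × H) where
  toFun p := WithLp.toLp 2 (-p.snd, p.fst)
  map_add' p q := by
    rw [← WithLp.toLp_add]
    congr 1
    ext <;> simp [add_comm]
  map_smul' a p := by
    rw [← WithLp.toLp_smul]
    congr 1
    ext <;> simp

theorem rotAux_realifyAux (c : H ≃ₗᵢ⋆[ℂ] H) (v : H) :
    rotAux (realifyAux c v) = realifyAux c (Complex.I • v) := by
  simp only [rotAux, realifyAux, LinearMap.coe_mk, AddHom.coe_mk]
  congr 1
  ext
  · simp only [map_smulₛₗ, Complex.conj_I]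
    change -((1 / (2 * Complex.I) : ℂ) • (v - c v)) = _
    rw [← smul_neg, neg_sub, neg_smul, ← sub_eq_add_neg, ← smul_sub, smul_smul, ← neg_sub (c v) v,
      smul_neg, ← neg_smul]
    congr 1
    field_simp
    simp
  · simp only [map_smulₛₗ, Complex.conj_I]
    change (1 / 2 : ℂ) • (v + c v) = _
    rw [neg_smul, sub_neg_eq_add, ← smul_add, smul_smul]
    congr 1
    field_simp

section Operators

variable [FiniteDimensional ℂ H]

/-- The operator `J (v, w) = (-w, v)` on `H_ℝ`. -/
def J (c : H ≃ₗᵢ⋆[ℂ] H) : realification c →L[ℝ] realification c :=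
  LinearMap.toContinuousLinearMap (rotAux.restrict (p := realification c) (q := realification c)
    (by
      rintro _ ⟨v, rfl⟩
      exact ⟨Complex.I • v, (rotAux_realifyAux c v).symm⟩))

/-- The operator `u u*`, that is `ξ ↦ ⟨ξ, u⟩ u`. -/
abbrev outer {E : Type*} [NormedAddCommGroup E] [InnerProductSpace ℝ E] (u : E) : E →L[ℝ] E :=
  InnerProductSpace.rankOne ℝ u u

/-- `Φ = φ φ* + J φ φ* J*` on `H_ℝ`, with `φ = ι(f)`: the realification of the operator `f f*`. -/
def Φ (c : H ≃ₗᵢ⋆[ℂ] H) (f : H) : realification c →L[ℝ] realification c :=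
  outer (ι c f) + J c * outer (ι c f) * ContinuousLinearMap.adjoint (J c)

/-- `Π = 1 - J ψ₀ ψ₀* J*`, with `ψ₀ = ι(z₀)`. -/
def proj (c : H ≃ₗᵢ⋆[ℂ] H) (z₀ : H) : realification c →L[ℝ] realification c :=
  1 - J c * outer (ι c z₀) * ContinuousLinearMap.adjoint (J c)

/-- The operator `∑ₖ Π Φₖ ζ ζ* Φₖ Π`, with `ζ = ι(x)`. -/
def fisherSum {m : ℕ} (c : H ≃ₗᵢ⋆[ℂ] H) (f : Fin m → H) (z₀ x : H) :
    realification c →L[ℝ] realification c :=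
  ∑ k, proj c z₀ * Φ c (f k) * outer (ι c x) * Φ c (f k) * proj c z₀

/-- `H_{z₀} = {ξ ∈ H_ℝ : ⟨ξ, ψ₀⟩ ≥ 0, ⟨ξ, J ψ₀⟩ = 0}`, with `ψ₀ = ι(z₀)`. -/
def halfSpace (c : H ≃ₗᵢ⋆[ℂ] H) (z₀ : H) : Set (realification c) :=
  {ξ | 0 ≤ inner ℝ ξ (ι c z₀) ∧ inner ℝ ξ (J c (ι c z₀)) = 0}

end Operators

/-- `ω` is unbiased: `E[ω(y) | x] = ι(x)` for every admissible signal `x`. -/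
def IsUnbiased {m : ℕ} (c : H ≃ₗᵢ⋆[ℂ] H) (f : Fin m → H) (σ : ℝ) (z₀ : H)
    (ω : (Fin m → ℝ) → realification c) : Prop :=
  ∀ x ∈ admissible z₀, Integrable ω (obsLaw f σ x) ∧ ∫ y, ω y ∂(obsLaw f σ x) = ι c x

/-- `ω` is unbiased at `x` to first order: `E[ω(y) | x] = ι(x)`, and for admissible signals `x'` that
tend to `x` the bias `E[ω(y) | x'] - ι(x')` is `o(‖x' - x‖)`. -/
structure IsUnbiasedAt {m : ℕ} (c : H ≃ₗᵢ⋆[ℂ] H) (f : Fin m → H) (σ : ℝ) (z₀ x : H)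
    (ω : (Fin m → ℝ) → realification c) : Prop where
  integrable_self : Integrable ω (obsLaw f σ x)
  integral_self : ∫ y, ω y ∂(obsLaw f σ x) = ι c x
  integrable : ∀ᶠ x' in 𝓝[admissible z₀] x, Integrable ω (obsLaw f σ x')
  isLittleO : (fun x' => ∫ y, ω y ∂(obsLaw f σ x') - ι c x')
    =o[𝓝[admissible z₀] x] fun x' => x' - x

/-- Being unbiased at every admissible signal is a stronger requirement. -/
theorem IsUnbiased.isUnbiasedAt {m : ℕ} {c : H ≃ₗᵢ⋆[ℂ] H} {f : Fin m → H} {σ : ℝ} {z₀ x : H}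
    {ω : (Fin m → ℝ) → realification c} (h : IsUnbiased c f σ z₀ ω) (hx : x ∈ admissible z₀) :
    IsUnbiasedAt c f σ z₀ x ω where
  integrable_self := (h x hx).1
  integral_self := (h x hx).2
  integrable := eventually_nhdsWithin_of_forall fun x' hx' => (h x' hx').1
  isLittleO := by
    refine (Asymptotics.isLittleO_zero _ _).congr' ?_ EventuallyEq.rfl
    refine eventually_nhdsWithin_of_forall fun x' hx' => ?_
    simp [(h x' hx').2]

end Model

end PhaseRetrieval

end

open PhaseRetrieval

/-!
The bound is a Cramér-Rao inequality on the real hyperplane `⟨ξ, J ψ₀⟩ = 0`, the range of `Π`.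
Since the estimator is only known to be unbiased along admissible signals, and only to first order,
nothing is differentiated under the integral sign. Instead the Chapman-Robbins inequality
(`sq_integral_withDensity_sub_le`), which is the Cauchy-Schwarz inequality for `L - 1` and
`X - E X` with a likelihood ratio `L`, compares the laws of `y` at two signals. For Gaussian laws
`∫ L² = exp (|δ|² / σ²)`, where `δ` is the difference of the means
(`sq_integral_pi_gaussianReal_sub_le`).

Applied to `X = ⟨ω, η⟩` at the signals `x` and `x + t v`, divided by `t²`, with `t → 0`, it becomes
`⟨η, ι v⟩² ≤ (4 / σ²) ⟨F ι v, ι v⟩ ⟨Cov[ω] η, η⟩` for every tangent direction `v`, where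
`F = ∑ₖ Π Φₖ ζ ζ* Φₖ Π` (`IsUnbiasedAt.sq_inner_le`); first-order unbiasedness gives the limit of the
left-hand side (`IsUnbiasedAt.tendsto_slope`), and the derivative `2 ⟨Φₖ ζ, ι v⟩` of the
measurements that of the right-hand side. The choice `ι v = F† η`, which lies in the range of `Π`
because `F` is self-adjoint and `Π F = F`, satisfies `⟨F F† η, F† η⟩ = ⟨F† η, η⟩`, and a factor
cancels (`smul_pinv_le_of_sq_inner_le`). The bound for the mean square error is the trace of the
operator inequality when that error is finite, which forces `ω` to be square integrable.
-/

namespace PhaseRetrieval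

/-! ### The Chapman-Robbins inequality -/

section ChapmanRobbins

variable {Y : Type*} [MeasurableSpace Y] {P : Measure Y}

theorem sq_integral_mul_le {f g : Y → ℝ} (hf : MemLp f 2 P) (hg : MemLp g 2 P) :
    (∫ y, f y * g y ∂P) ^ 2 ≤ (∫ y, f y ^ 2 ∂P) * ∫ y, g y ^ 2 ∂P := by
  have hff := hf.integrable_sq
  have hgg := hg.integrable_sq
  have hfg : Integrable (fun y => f y * g y) P := hf.integrable_mul hg
  have key : ∀ t : ℝ, 0 ≤ (∫ y, g y ^ 2 ∂P) * (t * t) + (2 * ∫ y, f y * g y ∂P) * t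
      + ∫ y, f y ^ 2 ∂P := by
    intro t
    have h : ∫ y, (f y + t * g y) ^ 2 ∂P = (∫ y, g y ^ 2 ∂P) * (t * t)
        + (2 * ∫ y, f y * g y ∂P) * t + ∫ y, f y ^ 2 ∂P := by
      have e : ∀ y, (f y + t * g y) ^ 2 = (t * t) * g y ^ 2 + (2 * t) * (f y * g y) + f y ^ 2 :=
        fun y => by ring
      simp_rw [e]
      have i1 : Integrable (fun y => (t * t) * g y ^ 2) P := hgg.const_mul _
      have i2 : Integrable (fun y => (2 * t) * (f y * g y)) P := hfg.const_mul _
      have i3 : Integrable (fun y => (t * t) * g y ^ 2 + (2 * t) * (f y * g y)) P := i1.add i2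
      rw [integral_add i3 hff, integral_add i1 i2, integral_const_mul, integral_const_mul]
      ring
    rw [← h]
    positivity
  have := discrim_le_zero key
  rw [discrim] at this
  linarith

/-- The Chapman-Robbins inequality: if `L` is the likelihood ratio `dQ/dP`, the shift of the mean of
a statistic `X` from `P` to `Q` is at most the standard deviation of `X` under `P` times the square
root of the `χ²`-divergence `∫ L² dP - 1`. -/
theorem sq_integral_withDensity_sub_le [IsProbabilityMeasure P] {L X : Y → ℝ}
    (hLm : Measurable L) (hL0 : 0 ≤ L) (hL : MemLp L 2 P) (hL1 : ∫ y, L y ∂P = 1)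
    (hX : MemLp X 2 P) :
    (∫ y, X y ∂(P.withDensity fun y => ENNReal.ofReal (L y)) - ∫ y, X y ∂P) ^ 2 ≤
      (∫ y, L y ^ 2 ∂P - 1) * ∫ y, (X y - ∫ z, X z ∂P) ^ 2 ∂P := by
  have hLi : Integrable L P := hL.integrable (by norm_num)
  have hXi : Integrable X P := hX.integrable (by norm_num)
  have hLX : Integrable (fun y => L y * X y) P := hL.integrable_mul hX
  set a := ∫ y, X y ∂P with ha
  have h1 : ∫ y, X y ∂(P.withDensity fun y => ENNReal.ofReal (L y)) = ∫ y, L y * X y ∂P := by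
    rw [integral_withDensity_eq_integral_toReal_smul hLm.ennreal_ofReal (by simp)]
    exact integral_congr_ae (.of_forall fun y => by simp [ENNReal.toReal_ofReal (hL0 y)])
  have h2 : ∫ y, (L y - 1) * (X y - a) ∂P = ∫ y, L y * X y ∂P - a := by
    have e : ∀ y, (L y - 1) * (X y - a) = (L y * X y - X y) - a * (L y - 1) := fun y => by ring
    simp_rw [e]
    have i1 : Integrable (fun y => L y * X y - X y) P := hLX.sub hXi
    have i2 : Integrable (fun y => a * (L y - 1)) P := (hLi.sub (integrable_const 1)).const_mul a
    rw [integral_sub i1 i2, integral_sub hLX hXi, integral_const_mul, integral_sub hLi (integrable_const 1), hL1]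
    simp [ha]
  have h3 : ∫ y, (L y - 1) ^ 2 ∂P = ∫ y, L y ^ 2 ∂P - 1 := by
    have e : ∀ y, (L y - 1) ^ 2 = L y ^ 2 - (2 * L y - 1) := fun y => by ring
    simp_rw [e]
    have i1 : Integrable (fun y => 2 * L y - 1) P := (hLi.const_mul 2).sub (integrable_const 1)
    rw [integral_sub hL.integrable_sq i1,
      integral_sub (hLi.const_mul 2) (integrable_const 1), integral_const_mul, hL1]
    norm_num
  rw [h1, ← h2, ← h3]
  exact sq_integral_mul_le (hL.sub (memLp_const 1)) (hX.sub (memLp_const a))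

end ChapmanRobbins

/-! ### Likelihood ratios of Gaussian shifts -/

section Gaussian

/-- The likelihood ratio `dN(μ + δ, v)/dN(μ, v)`. -/
noncomputable def gaussianRatio (μ : ℝ) (v : ℝ≥0) (δ y : ℝ) : ℝ :=
  Real.exp (δ * (y - μ) / v - δ ^ 2 / (2 * v))

theorem measurable_gaussianRatio (μ : ℝ) (v : ℝ≥0) (δ : ℝ) : Measurable (gaussianRatio μ v δ) := by
  unfold gaussianRatio
  fun_prop

theorem gaussianRatio_pos (μ : ℝ) (v : ℝ≥0) (δ y : ℝ) : 0 < gaussianRatio μ v δ y := Real.exp_pos _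

theorem gaussianRatio_mul_gaussianPDFReal (μ : ℝ) {v : ℝ≥0} (hv : v ≠ 0) (δ y : ℝ) :
    gaussianPDFReal μ v y * gaussianRatio μ v δ y = gaussianPDFReal (μ + δ) v y := by
  have hv' : (v : ℝ) ≠ 0 := by exact_mod_cast hv
  rw [gaussianRatio, gaussianPDFReal, gaussianPDFReal, mul_assoc, ← Real.exp_add]
  congr 2
  field_simp
  ring

theorem gaussianReal_add_eq_withDensity (μ : ℝ) {v : ℝ≥0} (hv : v ≠ 0) (δ : ℝ) :
    gaussianReal (μ + δ) v =
      (gaussianReal μ v).withDensity fun y => ENNReal.ofReal (gaussianRatio μ v δ y) := by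
  rw [gaussianReal_of_var_ne_zero _ hv, gaussianReal_of_var_ne_zero _ hv,
    ← withDensity_mul _ (measurable_gaussianPDF μ v)
      (measurable_gaussianRatio μ v δ).ennreal_ofReal]
  congr 1
  ext y
  rw [Pi.mul_apply, gaussianPDF, gaussianPDF, ← gaussianRatio_mul_gaussianPDFReal μ hv,
    ENNReal.ofReal_mul (gaussianPDFReal_nonneg _ _ _)]

theorem integrable_gaussianRatio (μ : ℝ) (v : ℝ≥0) (δ : ℝ) :
    Integrable (gaussianRatio μ v δ) (gaussianReal μ v) := by
  have h := (integrable_exp_mul_gaussianReal (μ := μ) (v := v) (δ / v)).const_mul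
    (Real.exp (-(δ * μ / v) - δ ^ 2 / (2 * v)))
  refine h.congr (.of_forall fun y => ?_)
  simp only [gaussianRatio, ← Real.exp_add]
  congr 1
  ring

theorem integral_gaussianRatio (μ : ℝ) {v : ℝ≥0} (hv : v ≠ 0) (δ : ℝ) :
    ∫ y, gaussianRatio μ v δ y ∂(gaussianReal μ v) = 1 := by
  rw [integral_gaussianReal_eq_integral_smul hv]
  simp_rw [smul_eq_mul, gaussianRatio_mul_gaussianPDFReal μ hv]
  exact integral_gaussianPDFReal_eq_one _ hv

/-- Squaring the ratio doubles the shift, up to a constant factor. -/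
theorem gaussianRatio_sq (μ : ℝ) (v : ℝ≥0) (δ y : ℝ) :
    gaussianRatio μ v δ y ^ 2 = Real.exp (δ ^ 2 / v) * gaussianRatio μ v (2 * δ) y := by
  simp only [gaussianRatio, ← Real.exp_add, ← Real.exp_nat_mul]
  congr 1
  push_cast
  ring

variable {κ : Type*} [Fintype κ]

/-- The likelihood ratio of two product Gaussian laws with the same variances. -/
theorem pi_gaussianReal_eq_withDensity (μ δ : κ → ℝ) {v : ℝ≥0} (hv : v ≠ 0) :
    Measure.pi (fun k => gaussianReal (μ k + δ k) v) =
      (Measure.pi fun k => gaussianReal (μ k) v).withDensity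
        fun y => ENNReal.ofReal (∏ k, gaussianRatio (μ k) v (δ k) (y k)) := by
  refine Measure.pi_eq fun s hs => ?_
  rw [withDensity_apply _ (MeasurableSet.univ_pi hs), Measure.restrict_pi_pi,
    ← ofReal_integral_eq_lintegral_ofReal
      (Integrable.fintype_prod fun k => (integrable_gaussianRatio (μ k) v (δ k)).restrict)
      (.of_forall fun y => Finset.prod_nonneg fun k _ => (gaussianRatio_pos _ _ _ _).le),
    integral_fintype_prod_eq_prod (f := fun k y => gaussianRatio (μ k) v (δ k) y),
    ENNReal.ofReal_prod_of_nonneg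
      fun k _ => integral_nonneg fun y => (gaussianRatio_pos _ _ _ _).le]
  refine Finset.prod_congr rfl fun k _ => ?_
  rw [ofReal_integral_eq_lintegral_ofReal (integrable_gaussianRatio (μ k) v (δ k)).restrict
    (.of_forall fun y => (gaussianRatio_pos _ _ _ _).le), gaussianReal_add_eq_withDensity _ hv,
    withDensity_apply _ (hs k)]

/-- The Chapman-Robbins inequality for Gaussian laws with independent components: the
`χ²`-divergence of a shift by `δ` is `exp (|δ|² / v) - 1`. -/
theorem sq_integral_pi_gaussianReal_sub_le (μ μ' : κ → ℝ) {v : ℝ≥0} (hv : v ≠ 0)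
    {X : (κ → ℝ) → ℝ} (hX : MemLp X 2 (Measure.pi fun k => gaussianReal (μ k) v)) :
    (∫ y, X y ∂(Measure.pi fun k => gaussianReal (μ' k) v)
        - ∫ y, X y ∂(Measure.pi fun k => gaussianReal (μ k) v)) ^ 2 ≤
      (Real.exp (∑ k, (μ' k - μ k) ^ 2 / v) - 1) *
        ∫ y, (X y - ∫ z, X z ∂(Measure.pi fun k => gaussianReal (μ k) v)) ^ 2
          ∂(Measure.pi fun k => gaussianReal (μ k) v) := by
  obtain ⟨δ, rfl⟩ : ∃ δ : κ → ℝ, μ' = μ + δ := ⟨μ' - μ, by simp⟩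
  simp only [Pi.add_apply, add_sub_cancel_left]
  let L : (κ → ℝ) → ℝ := fun y => ∏ k, gaussianRatio (μ k) v (δ k) (y k)
  have hLm : Measurable L := Finset.measurable_fun_prod _ fun k _ =>
    (measurable_gaussianRatio _ _ _).comp (measurable_pi_apply k)
  have hsq : ∀ y, L y ^ 2 =
      ∏ k, Real.exp (δ k ^ 2 / v) * gaussianRatio (μ k) v (2 * δ k) (y k) := fun y => by
    simp only [L, ← Finset.prod_pow, gaussianRatio_sq]
  have hL : MemLp L 2 (Measure.pi fun k => gaussianReal (μ k) v) := by
    rw [memLp_two_iff_integrable_sq hLm.aestronglyMeasurable]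
    simp_rw [hsq]
    exact Integrable.fintype_prod
      (f := fun k y => Real.exp (δ k ^ 2 / v) * gaussianRatio (μ k) v (2 * δ k) y)
      fun k => (integrable_gaussianRatio _ _ _).const_mul _
  have hL1 : ∫ y, L y ∂(Measure.pi fun k => gaussianReal (μ k) v) = 1 := by
    simp only [L]
    rw [integral_fintype_prod_eq_prod (f := fun k y => gaussianRatio (μ k) v (δ k) y)]
    simp [integral_gaussianRatio _ hv]
  have hL2 : ∫ y, L y ^ 2 ∂(Measure.pi fun k => gaussianReal (μ k) v) =
      Real.exp (∑ k, δ k ^ 2 / v) := by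
    simp_rw [hsq]
    rw [integral_fintype_prod_eq_prod
      (f := fun k y => Real.exp (δ k ^ 2 / v) * gaussianRatio (μ k) v (2 * δ k) y)]
    simp [integral_const_mul, integral_gaussianRatio _ hv, Real.exp_sum]
  have h := sq_integral_withDensity_sub_le hLm
    (fun y => Finset.prod_nonneg fun k _ => (gaussianRatio_pos _ _ _ _).le) hL hL1 hX
  rwa [hL2, ← pi_gaussianReal_eq_withDensity μ δ hv] at h

end Gaussian

/-! ### Covariance operators -/

section CovOp

variable {Y : Type*} [MeasurableSpace Y] {P : Measure Y}
  {E : Type*} [NormedAddCommGroup E] [InnerProductSpace ℝ E] {X : Y → E}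

theorem integrable_rankOne_self (hX : MemLp X 2 P) :
    Integrable (fun y => InnerProductSpace.rankOne ℝ (X y) (X y)) P := by
  refine Integrable.mono' (g := fun y => ‖X y‖ ^ 2) hX.norm.integrable_sq ?_
    (.of_forall fun y => by simp [sq])
  have h : Continuous fun u : E => InnerProductSpace.rankOne ℝ u u :=
    (InnerProductSpace.rankOne ℝ).continuous.clm_apply continuous_id
  exact h.comp_aestronglyMeasurable hX.1

variable [IsProbabilityMeasure P] [FiniteDimensional ℝ E]

theorem inner_covOp_apply (hX : MemLp X 2 P) (ξ η : E) :
    inner ℝ (covOp X P ξ) η =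
      ∫ y, inner ℝ (X y - ∫ z, X z ∂P) ξ * inner ℝ (X y - ∫ z, X z ∂P) η ∂P := by
  have hi : Integrable (fun y => InnerProductSpace.rankOne ℝ (X y - ∫ z, X z ∂P)
      (X y - ∫ z, X z ∂P)) P := integrable_rankOne_self (hX.sub (memLp_const (∫ z, X z ∂P)))
  have hξ := hi.apply_continuousLinearMap ξ
  have h1 : covOp X P ξ = ∫ y, InnerProductSpace.rankOne ℝ (X y - ∫ z, X z ∂P)
      (X y - ∫ z, X z ∂P) ξ ∂P := ContinuousLinearMap.integral_apply hi ξ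
  rw [h1, real_inner_comm, ← integral_inner hξ]
  refine integral_congr_ae (.of_forall fun y => ?_)
  simp only [InnerProductSpace.rankOne_apply]
  rw [real_inner_smul_right, real_inner_comm η]

theorem covOp_isSymmetric (hX : MemLp X 2 P) : (covOp X P).IsSymmetric := by
  intro ξ η
  rw [ContinuousLinearMap.coe_coe, inner_covOp_apply hX, real_inner_comm, inner_covOp_apply hX]
  simp_rw [mul_comm]

/-- The quadratic form of the covariance operator at `η` is the variance of `⟨X, η⟩`. -/
theorem inner_covOp_self (hX : MemLp X 2 P) (η : E) :
    inner ℝ (covOp X P η) η =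
      ∫ y, (inner ℝ η (X y) - ∫ z, inner ℝ η (X z) ∂P) ^ 2 ∂P := by
  rw [inner_covOp_apply hX, integral_inner (hX.integrable (by norm_num))]
  simp_rw [real_inner_comm η, inner_sub_right, sq]

theorem trace_covOp (hX : MemLp X 2 P) :
    LinearMap.trace ℝ E (covOp X P).toLinearMap = ∫ y, ‖X y - ∫ z, X z ∂P‖ ^ 2 ∂P := by
  let b := stdOrthonormalBasis ℝ E
  have hXc := hX.sub (memLp_const (∫ z, X z ∂P))
  rw [LinearMap.trace_eq_sum_inner _ b]
  simp_rw [← b.sum_sq_norm_inner_right]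
  rw [integral_finsetSum _ fun i _ => (hXc.const_inner (b i)).norm.integrable_sq]
  refine Finset.sum_congr rfl fun i _ => ?_
  rw [ContinuousLinearMap.coe_coe, real_inner_comm, inner_covOp_apply hX]
  refine integral_congr_ae (.of_forall fun y => ?_)
  simp [real_inner_comm, sq]

end CovOp

/-! ### Pseudoinverses of positive operators -/

section Pseudoinverse

variable {E : Type*} [NormedAddCommGroup E] [InnerProductSpace ℝ E] [FiniteDimensional ℝ E]

theorem isSelfAdjoint_pinv {T : E →L[ℝ] E} (hT : IsSelfAdjoint T) : IsSelfAdjoint (pinv T) := by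
  have h := isMoorePenrose_pinv T
  have hT' : star T = T := hT
  refine IsMoorePenrose.unique (T := T) ⟨?_, ?_, ?_, ?_⟩ h
  · simpa [hT', mul_assoc] using congrArg star h.mul_mul_self
  · simpa [hT', mul_assoc] using congrArg star h.self_mul_mul
  · have := h.selfAdjoint_right.star_eq
    rw [star_mul, hT'] at this
    rw [this]
    exact h.selfAdjoint_right
  · have := h.selfAdjoint_left.star_eq
    rw [star_mul, hT'] at this
    rw [this]
    exact h.selfAdjoint_left

theorem inner_apply_pinv_self (T : E →L[ℝ] E) (hT : IsSelfAdjoint T) (η : E) :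
    inner ℝ (T (pinv T η)) (pinv T η) = inner ℝ (pinv T η) η := by
  have h := (isSelfAdjoint_pinv hT).isSymmetric (T (pinv T η)) η
  rw [ContinuousLinearMap.coe_coe] at h
  rw [← h]
  exact congrArg (fun S : E →L[ℝ] E => inner ℝ (S η) η) (isMoorePenrose_pinv T).self_mul_mul

/-- An operator that fixes the range of a self-adjoint operator pointwise fixes that of its
pseudoinverse. -/
theorem mul_pinv_of_mul_eq {A T : E →L[ℝ] E} (hT : IsSelfAdjoint T) (hA : A * T = T) :
    A * pinv T = pinv T := by
  have h := isMoorePenrose_pinv T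
  have e : pinv T = T * (pinv T * pinv T) := by
    have h1 := h.selfAdjoint_right.star_eq
    rw [star_mul, hT.star_eq, (isSelfAdjoint_pinv hT).star_eq] at h1
    rw [← mul_assoc, h1, h.self_mul_mul]
  rw [e, ← mul_assoc, hA]

/-- From the information inequality in Cauchy-Schwarz form to its form with the pseudoinverse:
it is enough to test the former at `ξ = T† η`. -/
theorem smul_pinv_le_of_sq_inner_le {C T : E →L[ℝ] E} (hC : C.IsSymmetric)
    (hT : T.IsPositive) {a : ℝ} (ha : 0 < a)
    (h : ∀ η, inner ℝ (pinv T η) η ^ 2 ≤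
      a * inner ℝ (T (pinv T η)) (pinv T η) * inner ℝ (C η) η)
    (hC0 : ∀ η, 0 ≤ inner ℝ (C η) η) : a⁻¹ • pinv T ≤ C := by
  have hS := isSelfAdjoint_pinv hT.isSelfAdjoint
  rw [ContinuousLinearMap.le_def, ContinuousLinearMap.isPositive_iff]
  refine ⟨fun ξ η => ?_, fun η => ?_⟩
  · have h1 := hC ξ η
    have h2 := hS.isSymmetric ξ η
    simp only [ContinuousLinearMap.coe_coe] at h1 h2
    simp [inner_sub_left, inner_sub_right, real_inner_smul_left, real_inner_smul_right, h1, h2]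
  · have h1 := h η
    have h2 : 0 ≤ inner ℝ (pinv T η) η := by
      rw [← inner_apply_pinv_self T hT.isSelfAdjoint]
      exact hT.inner_nonneg_left _
    rw [inner_apply_pinv_self T hT.isSelfAdjoint] at h1
    rw [sub_apply, smul_apply, inner_sub_left,
      real_inner_smul_left, sub_nonneg, inv_mul_le_iff₀ ha]
    rcases h2.eq_or_lt with h0 | h0
    · rw [← h0]
      exact mul_nonneg ha.le (hC0 η)
    · nlinarith

end Pseudoinverse

/-! ### Tangent directions -/

section Tangent

variable {H : Type*} [NormedAddCommGroup H] [InnerProductSpace ℂ H]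

/-- The tangent directions `v` at an admissible signal are those with `⟨v, z₀⟩` real. -/
theorem tendsto_add_smul_admissible {z₀ x v : H} (hx : x ∈ admissible z₀)
    (hv : (inner ℂ z₀ v).im = 0) :
    Tendsto (fun t : ℝ => x + t • v) (𝓝[≠] 0) (𝓝[admissible z₀] x) := by
  have hpath : ContinuousAt (fun t : ℝ => x + t • v) 0 := by fun_prop
  have h0 := hpath.tendsto
  simp only [zero_smul, add_zero] at h0
  refine tendsto_nhdsWithin_iff.2 ⟨h0.mono_left nhdsWithin_le_nhds, ?_⟩
  refine Eventually.filter_mono nhdsWithin_le_nhds ?_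
  have h : ∀ t : ℝ, inner ℂ z₀ (x + t • v) = inner ℂ z₀ x + t * inner ℂ z₀ v := fun t => by
    rw [← Complex.coe_smul t v, inner_add_right, inner_smul_right]
  have hc : ContinuousAt (fun t : ℝ => (inner ℂ z₀ x).re + t * (inner ℂ z₀ v).re) 0 := by fun_prop
  filter_upwards [hc.eventually (lt_mem_nhds (a := 0) (by simpa using hx.1))] with t ht
  refine ⟨?_, ?_⟩
  · simpa [h] using ht
  · simp [h, hv, hx.2]

variable {c : H ≃ₗᵢ⋆[ℂ] H} {m : ℕ} {f : Fin m → H} {σ : ℝ} {z₀ x : H}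
  {ω : (Fin m → ℝ) → realification c}

/-- The mean of the estimator has derivative `ι(v)` in every tangent direction `v`. -/
theorem IsUnbiasedAt.tendsto_slope (h : IsUnbiasedAt c f σ z₀ x ω) (hx : x ∈ admissible z₀) {v : H}
    (hv : (inner ℂ z₀ v).im = 0) :
    Tendsto (fun t : ℝ => t⁻¹ • (∫ y, ω y ∂(obsLaw f σ (x + t • v)) - ι c x)) (𝓝[≠] 0)
      (𝓝 (ι c v)) := by
  have hpath := tendsto_add_smul_admissible hx hv
  have h1 := h.isLittleO.comp_tendsto hpath
  have h2 : (fun t : ℝ => ∫ y, ω y ∂(obsLaw f σ (x + t • v)) - ι c (x + t • v))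
      =o[𝓝[≠] 0] fun t : ℝ => t := by
    refine h1.trans_isBigO ?_
    refine Asymptotics.IsBigO.of_bound ‖v‖ (.of_forall fun t => ?_)
    simp [norm_smul, mul_comm]
  have h3 := (h2.tendsto_inv_smul_nhds_zero).add (tendsto_const_nhds (x := ι c v))
  rw [zero_add] at h3
  refine h3.congr' ?_
  filter_upwards [self_mem_nhdsWithin] with t ht
  have ht' : t ≠ 0 := ht
  rw [map_add, map_smul, ← sub_sub, smul_sub _ (_ - _), smul_smul, inv_mul_cancel₀ ht', one_smul,
    sub_add_cancel]

end Tangent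

/-! ### The realification and the measurements -/

section Realification

variable {H : Type*} [NormedAddCommGroup H] [InnerProductSpace ℂ H] (c : H ≃ₗᵢ⋆[ℂ] H)

theorem norm_ι (v : H) : ‖ι c v‖ = ‖v‖ := by
  have h : ‖ι c v‖ ^ 2 = ‖v‖ ^ 2 := by
    have h1 : ‖ι c v‖ ^ 2 = ‖(1 / 2 : ℂ) • (v + c v)‖ ^ 2
        + ‖(1 / (2 * Complex.I) : ℂ) • (v - c v)‖ ^ 2 :=
      WithLp.prod_norm_sq_eq_of_L2 (realifyAux c v)
    have h2 := parallelogram_law_with_norm ℂ v (c v)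
    rw [LinearIsometryEquiv.norm_map] at h2
    rw [h1, norm_smul, norm_smul]
    norm_num
    nlinarith
  exact (sq_eq_sq₀ (norm_nonneg _) (norm_nonneg _)).1 h

theorem inner_ι (v w : H) : inner ℝ (ι c v) (ι c w) = (inner ℂ v w).re := by
  have h := re_inner_eq_norm_add_mul_self_sub_norm_mul_self_sub_norm_mul_self_div_two (𝕜 := ℂ) v w
  rw [real_inner_eq_norm_add_mul_self_sub_norm_mul_self_sub_norm_mul_self_div_two, ← map_add,
    norm_ι, norm_ι, norm_ι, ← h]
  rfl

variable [FiniteDimensional ℂ H]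

theorem J_ι (v : H) : J c (ι c v) = ι c (Complex.I • v) :=
  Subtype.ext (rotAux_realifyAux c v)

theorem inner_J_ι (v w : H) : inner ℝ (J c (ι c v)) (ι c w) = (inner ℂ v w).im := by
  rw [J_ι, inner_ι, inner_smul_left]
  simp

theorem mul_outer_mul_adjoint {E : Type*} [NormedAddCommGroup E] [InnerProductSpace ℝ E]
    [FiniteDimensional ℝ E] (A : E →L[ℝ] E) (u : E) :
    A * outer u * ContinuousLinearMap.adjoint A = outer (A u) := by
  ext ξ
  simp [ContinuousLinearMap.adjoint_inner_right]

theorem Φ_eq (u : H) : Φ c u = outer (ι c u) + outer (J c (ι c u)) := by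
  rw [Φ, mul_outer_mul_adjoint]

theorem isSelfAdjoint_Φ (u : H) : IsSelfAdjoint (Φ c u) := by
  rw [Φ_eq]
  exact ((InnerProductSpace.isPositive_rankOne_self (ι c u)).add
    (InnerProductSpace.isPositive_rankOne_self (J c (ι c u)))).isSelfAdjoint

/-- `Φ` is the realification of the operator `u u*`. -/
theorem inner_Φ_ι (u v w : H) :
    inner ℝ (Φ c u (ι c v)) (ι c w) =
      (inner ℂ u v).re * (inner ℂ u w).re + (inner ℂ u v).im * (inner ℂ u w).im := by
  rw [Φ_eq]
  simp only [add_apply, outer, InnerProductSpace.rankOne_apply, inner_add_left,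
    real_inner_smul_left, inner_ι, inner_J_ι]

/-- The measurements along a line: their derivative at `v` in the direction `w` is
`2 ⟨Φₖ ι(v), ι(w)⟩`. -/
theorem intensity_add_smul {m : ℕ} (f : Fin m → H) (v w : H) (t : ℝ) (k : Fin m) :
    intensity f (v + t • w) k - intensity f v k =
      t * (2 * inner ℝ (Φ c (f k) (ι c v)) (ι c w) + t * intensity f w k) := by
  rw [inner_Φ_ι]
  simp only [intensity, ← Complex.normSq_eq_norm_sq, Complex.normSq_apply, inner_add_right,
    ← Complex.coe_smul t w, inner_smul_right, Complex.add_re, Complex.add_im, Complex.re_ofReal_mul,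
    Complex.im_ofReal_mul]
  ring

theorem proj_eq (z₀ : H) : proj c z₀ = 1 - outer (J c (ι c z₀)) := by
  rw [proj, mul_outer_mul_adjoint]

theorem isSymmetric_proj (z₀ : H) : (proj c z₀).IsSymmetric := by
  intro ξ η
  rw [proj_eq]
  simp [inner_sub_left, inner_sub_right, real_inner_smul_right, mul_comm, real_inner_comm]

theorem inner_J_proj {z₀ : H} (hz₀ : ‖z₀‖ = 1) (ξ : realification c) :
    inner ℝ (J c (ι c z₀)) (proj c z₀ ξ) = 0 := by
  have h : ‖J c (ι c z₀)‖ = 1 := by rw [J_ι, norm_ι, norm_smul, Complex.norm_I, one_mul, hz₀]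
  rw [proj_eq]
  simp [inner_sub_right, real_inner_smul_right, h]

theorem proj_apply_of_inner_eq_zero {z₀ : H} {ξ : realification c}
    (h : inner ℝ (J c (ι c z₀)) ξ = 0) : proj c z₀ ξ = ξ := by
  rw [proj_eq]
  simp [h]

theorem proj_mul_proj {z₀ : H} (hz₀ : ‖z₀‖ = 1) : proj c z₀ * proj c z₀ = proj c z₀ := by
  ext1 ξ
  exact proj_apply_of_inner_eq_zero c (inner_J_proj c hz₀ ξ)

variable {m : ℕ} (f : Fin m → H)

theorem fisherSum_eq (z₀ x : H) :
    fisherSum c f z₀ x = ∑ k, outer (proj c z₀ (Φ c (f k) (ι c x))) := by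
  refine Finset.sum_congr rfl fun k _ => ?_
  ext1 ξ
  have h1 := isSymmetric_proj c z₀ (Φ c (f k) (ι c x)) ξ
  have h2 := (isSelfAdjoint_Φ c (f k)).isSymmetric (ι c x) (proj c z₀ ξ)
  simp only [ContinuousLinearMap.coe_coe] at h1 h2
  simp only [mul_apply_eq_comp, outer, InnerProductSpace.rankOne_apply, map_smul, h1, h2]

theorem isPositive_fisherSum (z₀ x : H) : (fisherSum c f z₀ x).IsPositive := by
  rw [fisherSum_eq]
  exact Finset.sum_induction _ ContinuousLinearMap.IsPositive (fun _ _ h h' => h.add h')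
    ContinuousLinearMap.isPositive_zero
    fun k _ => InnerProductSpace.isPositive_rankOne_self _

theorem proj_mul_fisherSum {z₀ : H} (hz₀ : ‖z₀‖ = 1) (x : H) :
    proj c z₀ * fisherSum c f z₀ x = fisherSum c f z₀ x := by
  rw [fisherSum, Finset.mul_sum]
  simp only [← mul_assoc, proj_mul_proj c hz₀]

/-- On vectors fixed by `Π`, the quadratic form of `∑ₖ Π Φₖ ζ ζ* Φₖ Π` is a quarter of the squared
norm of the derivative of the measurements. -/
theorem inner_fisherSum_self {z₀ : H} (x : H) {ξ : realification c} (hξ : proj c z₀ ξ = ξ) :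
    inner ℝ (fisherSum c f z₀ x ξ) ξ = ∑ k, inner ℝ (Φ c (f k) (ι c x)) ξ ^ 2 := by
  rw [fisherSum_eq, sum_apply, sum_inner]
  refine Finset.sum_congr rfl fun k _ => ?_
  have h := isSymmetric_proj c z₀ (Φ c (f k) (ι c x)) ξ
  simp only [ContinuousLinearMap.coe_coe, hξ] at h
  rw [outer, InnerProductSpace.rankOne_apply, real_inner_smul_left, h, sq]

/-! ### The information inequality -/

variable {c f} {σ : ℝ} {z₀ x : H} {ω : (Fin m → ℝ) → realification c}

/-- The information inequality in Cauchy-Schwarz form: it is the limit of the Chapman-Robbins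
inequality between `x` and `x + t v`, divided by `t²`, as `t → 0`. -/
theorem IsUnbiasedAt.sq_inner_le (h : IsUnbiasedAt c f σ z₀ x ω) (hσ : 0 < σ)
    (hx : x ∈ admissible z₀) (hω : MemLp ω 2 (obsLaw f σ x)) {v : H}
    (hv : (inner ℂ z₀ v).im = 0) (η : realification c) :
    inner ℝ η (ι c v) ^ 2 ≤
      4 / σ ^ 2 * (∑ k, inner ℝ (Φ c (f k) (ι c x)) (ι c v) ^ 2) *
        inner ℝ (covOp ω (obsLaw f σ x) η) η := by
  have : IsProbabilityMeasure (obsLaw f σ x) := by unfold obsLaw; infer_instance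
  have hσ2 : (σ ^ 2).toNNReal ≠ 0 := by simpa using hσ.ne'
  have hσ3 : ((σ ^ 2).toNNReal : ℝ) = σ ^ 2 := Real.coe_toNNReal _ (sq_nonneg σ)
  set V := inner ℝ (covOp ω (obsLaw f σ x) η) η with hV
  have hV0 : 0 ≤ V := by
    rw [hV, inner_covOp_self hω]
    positivity
  -- `t² r(t)` is the squared distance of the means at `x` and `x + t v`, in units of `σ`
  let r : ℝ → ℝ := fun t =>
    ∑ k, (2 * inner ℝ (Φ c (f k) (ι c x)) (ι c v) + t * intensity f v k) ^ 2 / σ ^ 2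
  have hr : Continuous r := by fun_prop
  have hr0 : r 0 = 4 / σ ^ 2 * ∑ k, inner ℝ (Φ c (f k) (ι c x)) (ι c v) ^ 2 := by
    simp only [r, Finset.mul_sum]
    exact Finset.sum_congr rfl fun k _ => by ring
  have hpath := tendsto_add_smul_admissible hx hv
  have hle : ∀ᶠ t : ℝ in 𝓝[≠] 0,
      inner ℝ η (t⁻¹ • (∫ y, ω y ∂(obsLaw f σ (x + t • v)) - ι c x)) ^ 2 ≤
        r t * Real.exp (t ^ 2 * r t) * V := by
    filter_upwards [hpath.eventually h.integrable, self_mem_nhdsWithin] with t hint ht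
    have ht' : t ≠ 0 := ht
    have hCR := sq_integral_pi_gaussianReal_sub_le (intensity f x) (intensity f (x + t • v)) hσ2
      (hω.const_inner η)
    have hexp : ∑ k, (intensity f (x + t • v) k - intensity f x k) ^ 2
        / ((σ ^ 2).toNNReal : ℝ) = t ^ 2 * r t := by
      simp only [r, Finset.mul_sum, hσ3]
      exact Finset.sum_congr rfl fun k _ => by rw [intensity_add_smul c]; ring
    change (∫ y, inner ℝ η (ω y) ∂(obsLaw f σ (x + t • v)) -
      ∫ y, inner ℝ η (ω y) ∂(obsLaw f σ x)) ^ 2 ≤ _ * ∫ y, (inner ℝ η (ω y) -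
        ∫ z, inner ℝ η (ω z) ∂(obsLaw f σ x)) ^ 2 ∂(obsLaw f σ x) at hCR
    rw [hexp, ← inner_covOp_self hω, ← hV, integral_inner hint, integral_inner h.integrable_self,
      h.integral_self, ← inner_sub_right] at hCR
    -- `exp s - 1 ≤ s exp s`, because `1 - s ≤ exp (-s)`
    have hs : Real.exp (t ^ 2 * r t) - 1 ≤ t ^ 2 * r t * Real.exp (t ^ 2 * r t) := by
      have h1 := mul_le_mul_of_nonneg_right (Real.one_sub_le_exp_neg (t ^ 2 * r t))
        (Real.exp_pos (t ^ 2 * r t)).le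
      rw [← Real.exp_add, neg_add_cancel, Real.exp_zero] at h1
      linarith
    have h2 := hCR.trans (mul_le_mul_of_nonneg_right hs hV0)
    -- the scalar multiplication of the submodule `H_ℝ` agrees with that of the inner product space
    -- only after unfolding instances, so `rw` needs the rule in this form
    have h3 : ∀ u : realification c, inner ℝ η (t⁻¹ • u) = t⁻¹ * inner ℝ η u :=
      fun u => real_inner_smul_right (F := realification c) η u t⁻¹
    rw [h3, mul_pow, inv_pow, inv_mul_le_iff₀ (by positivity)]
    linarith
  have hlim : Tendsto (fun t => r t * Real.exp (t ^ 2 * r t) * V) (𝓝[≠] 0) (𝓝 (r 0 * V)) := by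
    have hcont : Continuous fun t => r t * Real.exp (t ^ 2 * r t) * V := by fun_prop
    have h0 := hcont.tendsto 0
    simp only [ne_eq, OfNat.ofNat_ne_zero, not_false_eq_true, zero_pow, zero_mul, Real.exp_zero,
      mul_one] at h0
    exact h0.mono_left nhdsWithin_le_nhds
  rw [← hr0]
  exact le_of_tendsto_of_tendsto
    ((tendsto_const_nhds.inner (h.tendsto_slope hx hv)).pow 2) hlim hle

theorem IsUnbiasedAt.smul_pinv_le_covOp (h : IsUnbiasedAt c f σ z₀ x ω) (hσ : 0 < σ)
    (hz₀ : ‖z₀‖ = 1) (hx : x ∈ admissible z₀) (hω : MemLp ω 2 (obsLaw f σ x)) :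
    (σ ^ 2 / 4) • pinv (fisherSum c f z₀ x) ≤ covOp ω (obsLaw f σ x) := by
  have : IsProbabilityMeasure (obsLaw f σ x) := by unfold obsLaw; infer_instance
  have hF := isPositive_fisherSum c f z₀ x
  rw [show σ ^ 2 / 4 = (4 / σ ^ 2)⁻¹ by rw [inv_div]]
  refine smul_pinv_le_of_sq_inner_le (covOp_isSymmetric hω) hF (by positivity) (fun η => ?_)
    fun η => ?_
  · have hP : proj c z₀ (pinv (fisherSum c f z₀ x) η) = pinv (fisherSum c f z₀ x) η :=
      congrArg (fun S : realification c →L[ℝ] realification c => S η)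
        (mul_pinv_of_mul_eq hF.isSelfAdjoint (proj_mul_fisherSum c f hz₀ x))
    rw [inner_fisherSum_self c f x hP, real_inner_comm]
    -- `T† η` is fixed by `Π`, so it is `ι(v)` for a tangent direction `v`
    have hJ := inner_J_proj c hz₀ (pinv (fisherSum c f z₀ x) η)
    rw [hP] at hJ
    obtain ⟨v, hv⟩ : ∃ v, ι c v = pinv (fisherSum c f z₀ x) η :=
      (realifyAux c).surjective_rangeRestrict _
    rw [← hv, inner_J_ι] at hJ
    rw [← hv]
    exact h.sq_inner_le hσ hx hω hJ η
  · rw [inner_covOp_self hω]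
    positivity

/-- Without a second moment the mean square error is infinite; otherwise the inequality is the
trace of the one for covariance operators. -/
theorem IsUnbiasedAt.ofReal_trace_pinv_le (h : IsUnbiasedAt c f σ z₀ x ω) (hσ : 0 < σ)
    (hz₀ : ‖z₀‖ = 1) (hx : x ∈ admissible z₀) :
    ENNReal.ofReal ((σ ^ 2 / 4) *
        LinearMap.trace ℝ (realification c) (pinv (fisherSum c f z₀ x)).toLinearMap) ≤
      ∫⁻ y, ‖ι c x - ω y‖ₑ ^ 2 ∂(obsLaw f σ x) := by
  have : IsProbabilityMeasure (obsLaw f σ x) := by unfold obsLaw; infer_instance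
  by_cases htop : ∫⁻ y, ‖ι c x - ω y‖ₑ ^ 2 ∂(obsLaw f σ x) = ∞
  · rw [htop]
    exact le_top
  have hmem : MemLp (fun y => ι c x - ω y) 2 (obsLaw f σ x) := by
    refine ⟨aestronglyMeasurable_const.sub h.integrable_self.1, ?_⟩
    rw [eLpNorm_lt_top_iff_lintegral_rpow_enorm_lt_top (by norm_num) (by norm_num)]
    simpa [lt_top_iff_ne_top] using htop
  have hω : MemLp ω 2 (obsLaw f σ x) := by
    simpa [Pi.sub_def] using (memLp_const (ι c x)).sub hmem
  have hle := LinearMap.IsPositive.trace_nonneg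
    ((ContinuousLinearMap.le_def _ _).1 (h.smul_pinv_le_covOp hσ hz₀ hx hω))
  have htr := trace_covOp hω
  rw [h.integral_self] at htr
  have hsq : ENNReal.ofReal (∫ y, ‖ω y - ι c x‖ ^ 2 ∂(obsLaw f σ x)) =
      ∫⁻ y, ‖ι c x - ω y‖ₑ ^ 2 ∂(obsLaw f σ x) := by
    have hint : Integrable (fun y => ‖ω y - ι c x‖ ^ 2) (obsLaw f σ x) :=
      (hω.sub (memLp_const _)).norm.integrable_sq
    rw [ofReal_integral_eq_lintegral_ofReal hint (.of_forall fun y => sq_nonneg _)]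
    refine lintegral_congr fun y => ?_
    rw [ENNReal.ofReal_pow (norm_nonneg _), ofReal_norm, enorm_sub_rev]
  rw [← hsq, ← htr]
  refine ENNReal.ofReal_le_ofReal ?_
  simpa using hle

end Realification

end PhaseRetrieval

theorem theorem4p2 {H : Type*} [NormedAddCommGroup H] [InnerProductSpace ℂ H]
    [FiniteDimensional ℂ H] (c : H ≃ₗᵢ⋆[ℂ] H) (hc : Function.Involutive c)
    {m : ℕ} (f : Fin m → H) (hinj : Function.Injective (α f))
    (σ : ℝ) (hσ : 0 < σ) (z₀ : H) (hz₀ : ‖z₀‖ = 1)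
    (x : H) (hx : x ∈ admissible z₀)
    (ω : (Fin m → ℝ) → realification c) (hω : ∀ y, ω y ∈ halfSpace c z₀)
    (hunb : IsUnbiasedAt c f σ z₀ x ω) :
    (MemLp ω 2 (obsLaw f σ x) →
      (σ ^ 2 / 4) • pinv (fisherSum c f z₀ x) ≤ covOp ω (obsLaw f σ x)) ∧
    ENNReal.ofReal ((σ ^ 2 / 4) *
        LinearMap.trace ℝ (realification c) (pinv (fisherSum c f z₀ x)).toLinearMap) ≤
      ∫⁻ y, ‖ι c x - ω y‖ₑ ^ 2 ∂(obsLaw f σ x) := by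
  exact ⟨hunb.smul_pinv_le_covOp hσ hz₀ hx, hunb.ofReal_trace_pinv_le hσ hz₀ hx⟩
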